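/- Let $G$ be an infinite bounded Abelian group (i.e. $nG=0$ for some integer $n\ge 1$). By Prüfer's theorem $G\cong\bigoplus_{p\in M}\bigoplus_{i=1}^{n_p}\mathbb{Z}(p^i)^{(k_{i,p})}$, where $M$ is the finite set of primes dividing $\exp(G)$, $n_p\ge 1$ and $k_{n_p,p}\neq 0$ for every $p\in M$; the cardinal numbers $k_{n_p,p}$, $p\in M$, are called the leading Ulm–Kaplansky invariants of $G$. (They do not depend on the decomposition: $n_p$ is the exponent of $p$ in $\exp(G)$, and $k_{i,p}=\dim_{\mathbb{F}_p}\,(p^{i-1}G)[p]/(p^{i}G)[p]$, where $A[p]=\{a\in A: pa=0\}$.) For a topological Abelian group $X$, the von Neumann radical $\mathbf{n}(X)$ is the intersection of the kernels of all continuous characters $X\to\mathbb{T}$. Let $\mathcal{NR}(G)$ (respectively, $\mathcal{NRC}(G)$) be the set of all subgroups $H$ of $G$ for which there is a non-discrete Hausdorff (respectively, a complete non-discrete Hausdorff) group topology $\tau$ on $G$ with $\mathbf{n}(G,\tau)=H$. Then all countable (finite or infinite) subgroups of $G$ belong to $\mathcal{NR}(G)$ if and only if all leading Ulm–Kaplansky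 invariants of $G$ are infinite. In this case all countable (finite or infinite) subgroups of $G$ belong to $\mathcal{NRC}(G)$. -/

import Mathlib

open scoped Cardinal DirectSum

universe u v

/-- The von Neumann radical of an abelian topological group: the intersection of the kernels of
all its continuous characters (homomorphisms into the circle group). -/
def vonNeumannRadical (G : Type*) [AddCommGroup G] [TopologicalSpace G] : AddSubgroup G where
  carrier := {x | ∀ χ : AddChar G Circle, Continuous χ → χ x = 1}
  zero_mem' := fun χ _ => χ.map_zero_eq_one
  add_mem' := fun {x y} hx hy χ hχ => by
    rw [AddChar.map_add_eq_mul, hx χ hχ, hy χ hχ, one_mul]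
  neg_mem' := fun {x} hx χ hχ => by
    rw [AddChar.map_neg_eq_inv, hx χ hχ, inv_one]

/-- `NR G`: the subgroups `H` of `G` for which there is a non-discrete Hausdorff group topology on
`G` with von Neumann radical `H`. -/
def NR (G : Type*) [AddCommGroup G] : Set (AddSubgroup G) :=
  {H | ∃ _τ : TopologicalSpace G, IsTopologicalAddGroup G ∧ T2Space G ∧ ¬ DiscreteTopology G ∧
    vonNeumannRadical G = H}

/-- `NRC G`: the subgroups `H` of `G` for which there is a complete non-discrete Hausdorff group
topology on `G` with von Neumann radical `H`. Completeness refers to the uniformity of the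
topological group (as `G` is abelian, the left and right uniformities agree). -/
def NRC (G : Type*) [AddCommGroup G] : Set (AddSubgroup G) :=
  {H | ∃ (_τ : TopologicalSpace G) (_ : IsTopologicalAddGroup G),
    @CompleteSpace G (IsTopologicalAddGroup.rightUniformSpace G) ∧
    T2Space G ∧ ¬ DiscreteTopology G ∧ vonNeumannRadical G = H}

/-- The subgroup `(p ^ n G)[p]` of elements of `p ^ n G` that are killed by `p`. -/
def pSocle (G : Type*) [AddCommGroup G] (p n : ℕ) : AddSubgroup G :=
  (nsmulAddMonoidHom (α := G) p).ker ⊓ (nsmulAddMonoidHom (α := G) (p ^ n)).range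

theorem mem_pSocle {G : Type*} [AddCommGroup G] {p n : ℕ} {x : G} :
    x ∈ pSocle G p n ↔ p • x = 0 ∧ ∃ y, p ^ n • y = x := by
  simp [pSocle, AddSubgroup.mem_inf, AddMonoidHom.mem_ker, AddMonoidHom.mem_range]

/-- The quotient `(p ^ n G)[p] / (p ^ (n + 1) G)[p]`. -/
abbrev UlmKaplanskyQuotient (G : Type*) [AddCommGroup G] (p n : ℕ) : Type _ :=
  pSocle G p n ⧸ (pSocle G p (n + 1)).addSubgroupOf (pSocle G p n)

instance UlmKaplanskyQuotient.module (G : Type*) [AddCommGroup G] (p n : ℕ) :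
    Module (ZMod p) (UlmKaplanskyQuotient G p n) :=
  QuotientAddGroup.zmodModule fun x => by
    have h : p • x = 0 := Subtype.ext (mem_pSocle.1 x.2).1
    rw [h]
    exact zero_mem _

/-- The Ulm–Kaplansky invariant `dim (p ^ n G)[p] / (p ^ (n + 1) G)[p]` over the field with `p`
elements. If `G` is a direct sum of finite cyclic groups of prime power order, it is the number of
summands isomorphic to `ℤ / p ^ (n + 1)`: see `ulmKaplanskyInvariant_eq`. -/
noncomputable def ulmKaplanskyInvariant (G : Type*) [AddCommGroup G] (p n : ℕ) : Cardinal :=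
  Module.rank (ZMod p) (UlmKaplanskyQuotient G p n)

/-- The leading Ulm–Kaplansky invariant at the prime `p ∣ exp G` of a bounded abelian group `G`. If
`G` is a direct sum of finite cyclic groups of prime power order, it is the number of summands
`ℤ / p ^ m` with the largest `m` that occurs for `p`: see `leadingUlmKaplanskyInvariant_eq`. -/
noncomputable def leadingUlmKaplanskyInvariant (G : Type*) [AddCommGroup G] (p : ℕ) : Cardinal :=
  ulmKaplanskyInvariant G p ((AddMonoid.exponent G).factorization p - 1)

section Decomposition

variable {G : Type*} [AddCommGroup G] {J : Type*} {q e : J → ℕ}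

open Classical in
/-- The generator of the summand with index `j`. -/
noncomputable def decompGen (φ : G ≃+ ⨁ j, ZMod (q j ^ e j)) (j : J) : G :=
  φ.symm (DirectSum.of (fun j => ZMod (q j ^ e j)) j 1)

open Classical in
theorem decompGen_apply (φ : G ≃+ ⨁ j, ZMod (q j ^ e j)) (j i : J) :
    φ (decompGen φ j) i = if j = i then 1 else 0 := by
  simp only [decompGen, AddEquiv.apply_symm_apply]
  split_ifs with h
  · subst h; rw [DirectSum.of_eq_same]
  · rw [DirectSum.of_eq_of_ne _ _ _ (Ne.symm h)]

theorem decomp_ext (φ : G ≃+ ⨁ j, ZMod (q j ^ e j)) {x y : G} (h : ∀ i, φ x i = φ y i) :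
    x = y := φ.injective (DFinsupp.ext h)

theorem decomp_nsmul_apply (φ : G ≃+ ⨁ j, ZMod (q j ^ e j)) (m : ℕ) (x : G) (i : J) :
    φ (m • x) i = m * φ x i := by
  rw [map_nsmul, DirectSum.smul_apply, nsmul_eq_mul]

theorem decompGen_nsmul_eq_zero (φ : G ≃+ ⨁ j, ZMod (q j ^ e j)) (j : J) (m : ℕ) :
    m • decompGen φ j = 0 ↔ q j ^ e j ∣ m := by
  rw [← ZMod.natCast_eq_zero_iff]
  constructor
  · intro h
    have := congrArg (fun x => φ x j) h
    simpa only [decomp_nsmul_apply, decompGen_apply, if_true, mul_one, map_zero,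
      DirectSum.zero_apply] using this
  · intro h
    refine decomp_ext φ fun i => ?_
    rw [decomp_nsmul_apply, decompGen_apply]
    split_ifs with hi
    · subst hi; simp [h]
    · simp

open Classical in
theorem decomp_eq_sum (hq : ∀ j, (q j).Prime) (φ : G ≃+ ⨁ j, ZMod (q j ^ e j)) (y : G) :
    y = ∑ j ∈ DFinsupp.support (φ y), (φ y j).val • decompGen φ j := by
  refine decomp_ext φ fun i => ?_
  have : NeZero (q i ^ e i) := ⟨pow_ne_zero _ (hq i).ne_zero⟩
  rw [map_sum, DirectSum.sum_apply]
  simp only [decomp_nsmul_apply, decompGen_apply]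
  rw [Finset.sum_eq_single i]
  · simp
  · intro b _ hb; simp [hb]
  · intro hi
    have : φ y i = 0 := by simpa using hi
    simp [this]

theorem decompGen_mem_pSocle (φ : G ≃+ ⨁ j, ZMod (q j ^ e j)) {p n : ℕ}
    (j : {j : J // q j = p ∧ e j = n + 1}) : p ^ n • decompGen φ j.1 ∈ pSocle G p n := by
  refine mem_pSocle.2 ⟨?_, _, rfl⟩
  rw [smul_smul, decompGen_nsmul_eq_zero, j.2.1, j.2.2, pow_succ, mul_comm]

/-- The Ulm–Kaplansky invariants of a direct sum of cyclic groups of prime power order count the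
summands of each isomorphism type. -/
theorem ulmKaplanskyInvariant_eq {G : Type u} [AddCommGroup G] {J : Type v} {q e : J → ℕ}
    (hq : ∀ j, (q j).Prime) (φ : G ≃+ ⨁ j, ZMod (q j ^ e j)) {p : ℕ} (hp : p.Prime) (n : ℕ) :
    Cardinal.lift.{v} (ulmKaplanskyInvariant G p n) =
      Cardinal.lift.{u} #{j : J // q j = p ∧ e j = n + 1} := by
  classical
  have : Fact p.Prime := ⟨hp⟩
  let v : {j : J // q j = p ∧ e j = n + 1} → UlmKaplanskyQuotient G p n := fun j =>
    QuotientAddGroup.mk ⟨p ^ n • decompGen φ j.1, decompGen_mem_pSocle φ j⟩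
  have hv : ∀ (c : ZMod p) j, c • v j = QuotientAddGroup.mk
      (c.val • (⟨p ^ n • decompGen φ j.1, decompGen_mem_pSocle φ j⟩ : pSocle G p n)) := by
    intro c j
    rw [QuotientAddGroup.mk_nsmul, ← Nat.cast_smul_eq_nsmul (ZMod p), ZMod.natCast_zmod_val]
  have hli : LinearIndependent (ZMod p) v := by
    rw [linearIndependent_iff']
    intro s c hs i hi
    simp only [hv] at hs
    rw [← QuotientAddGroup.mk_sum, QuotientAddGroup.eq_zero_iff, AddSubgroup.mem_addSubgroupOf,
      mem_pSocle] at hs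
    obtain ⟨-, y, hy⟩ := hs
    have h := congrArg (fun x => φ x i.1) hy
    simp only [AddSubgroup.val_finsetSum, AddSubgroup.coe_nsmul, map_sum, DirectSum.sum_apply,
      decomp_nsmul_apply, decompGen_apply] at h
    rw [Finset.sum_eq_single i] at h
    · have h0 : ((p ^ (n + 1) : ℕ) : ZMod (q i.1 ^ e i.1)) = 0 := by
        rw [ZMod.natCast_eq_zero_iff, i.2.1, i.2.2]
      rw [h0, zero_mul, if_pos rfl, mul_one, ← Nat.cast_mul, eq_comm, ZMod.natCast_eq_zero_iff,
        i.2.1, i.2.2, pow_succ, mul_comm] at h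
      have h2 : p ∣ (c i).val := Nat.dvd_of_mul_dvd_mul_right (pow_pos hp.pos n) h
      rw [← ZMod.natCast_zmod_val (c i)]
      exact (ZMod.natCast_eq_zero_iff _ _).2 h2
    · intro b _ hb
      rw [if_neg (fun h => hb (Subtype.ext h))]
      simp
    · intro h; exact absurd hi h
  have hsp : ⊤ ≤ Submodule.span (ZMod p) (Set.range v) := by
    rintro x -
    obtain ⟨⟨x, hx⟩, rfl⟩ := QuotientAddGroup.mk_surjective x
    obtain ⟨hpx, y, rfl⟩ := mem_pSocle.1 hx
    have hdvd : ∀ j, q j ^ e j ∣ p ^ (n + 1) * (φ y j).val := by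
      intro j
      have : NeZero (q j ^ e j) := ⟨pow_ne_zero _ (hq j).ne_zero⟩
      have h := congrArg (fun x => φ x j) hpx
      simp only [decomp_nsmul_apply, map_zero, DirectSum.zero_apply] at h
      rw [← ZMod.natCast_eq_zero_iff, Nat.cast_mul, ZMod.natCast_zmod_val, ← h]
      push_cast
      ring
    have hmem : ∀ j, p ^ n • (φ y j).val • decompGen φ j ∈ pSocle G p n := by
      intro j
      refine mem_pSocle.2 ⟨?_, _, rfl⟩
      rw [smul_smul, smul_smul, decompGen_nsmul_eq_zero]
      convert hdvd j using 1
      ring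
    have hsum : (⟨p ^ n • y, hx⟩ : pSocle G p n) =
        ∑ j ∈ DFinsupp.support (φ y), ⟨p ^ n • (φ y j).val • decompGen φ j, hmem j⟩ := by
      refine Subtype.ext ?_
      rw [AddSubgroup.val_finsetSum]
      simp only
      rw [← Finset.smul_sum, ← decomp_eq_sum hq φ y]
    rw [hsum, QuotientAddGroup.mk_sum]
    refine Submodule.sum_mem _ fun j _ => ?_
    by_cases hj : q j = p ∧ e j = n + 1
    · have : (QuotientAddGroup.mk ⟨p ^ n • (φ y j).val • decompGen φ j, hmem j⟩ :
          UlmKaplanskyQuotient G p n) = ((φ y j).val : ZMod p) • v ⟨j, hj⟩ := by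
        rw [Nat.cast_smul_eq_nsmul, ← QuotientAddGroup.mk_nsmul]
        congr 1
        exact Subtype.ext (smul_comm _ _ _)
      rw [this]
      exact Submodule.smul_mem _ _ (Submodule.subset_span ⟨_, rfl⟩)
    · have hz : (QuotientAddGroup.mk ⟨p ^ n • (φ y j).val • decompGen φ j, hmem j⟩ :
          UlmKaplanskyQuotient G p n) = 0 := by
        rw [QuotientAddGroup.eq_zero_iff, AddSubgroup.mem_addSubgroupOf]
        refine mem_pSocle.2 ⟨(mem_pSocle.1 (hmem j)).1, ?_⟩
        simp only
        have hd := hdvd j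
        by_cases hqp : q j = p
        · rcases Nat.lt_or_ge n (e j) with hlt | hge
          · have hlt2 : n + 2 ≤ e j := by
              have : e j ≠ n + 1 := fun h => hj ⟨hqp, h⟩
              omega
            have h2 : p ^ (n + 1) * p ∣ p ^ (n + 1) * (φ y j).val := by
              refine dvd_trans ?_ hd
              rw [hqp, ← pow_succ]
              exact pow_dvd_pow _ hlt2
            obtain ⟨b, hb⟩ := Nat.dvd_of_mul_dvd_mul_left (pow_pos hp.pos _) h2
            refine ⟨b • decompGen φ j, ?_⟩
            rw [hb, smul_smul, smul_smul, pow_succ, mul_assoc]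
          · refine ⟨0, ?_⟩
            rw [smul_zero, eq_comm, smul_smul, decompGen_nsmul_eq_zero]
            exact Dvd.dvd.mul_right (hqp ▸ pow_dvd_pow (q j) hge) _
        · refine ⟨0, ?_⟩
          have hc : Nat.Coprime (q j ^ e j) (p ^ (n + 1)) :=
            Nat.Coprime.pow _ _ ((Nat.coprime_primes (hq j) hp).2 hqp)
          rw [smul_zero, eq_comm, smul_smul, decompGen_nsmul_eq_zero]
          exact Dvd.dvd.mul_left (hc.dvd_of_dvd_mul_left hd) _
      rw [hz]
      exact zero_mem _
  exact (Module.Basis.mk hli hsp).mk_eq_rank.symm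

theorem decomp_dvd_exponent (φ : G ≃+ ⨁ j, ZMod (q j ^ e j)) (j : J) :
    q j ^ e j ∣ AddMonoid.exponent G :=
  (decompGen_nsmul_eq_zero φ j _).1 (AddMonoid.exponent_nsmul_eq_zero _)

theorem decomp_exponent_dvd (hq : ∀ j, (q j).Prime) (φ : G ≃+ ⨁ j, ZMod (q j ^ e j)) (m : ℕ)
    (h : ∀ j, q j ^ e j ∣ m) : AddMonoid.exponent G ∣ m := by
  classical
  refine AddMonoid.exponent_dvd_of_forall_nsmul_eq_zero fun y => ?_
  rw [decomp_eq_sum hq φ y, Finset.smul_sum]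
  refine Finset.sum_eq_zero fun j _ => ?_
  rw [smul_comm, (decompGen_nsmul_eq_zero φ j m).2 (h j), smul_zero]

/-- In a bounded direct sum of cyclic groups `ℤ / q ^ e` with `q` prime, the largest exponent `e`
that occurs for the prime `p` is the exponent of `p` in `exp G`. -/
theorem decomp_factorization (hq : ∀ j, (q j).Prime) (φ : G ≃+ ⨁ j, ZMod (q j ^ e j))
    (hG : AddMonoid.ExponentExists G) {p m : ℕ} (hp : p.Prime)
    (hm : IsGreatest {k | ∃ j, q j = p ∧ e j = k} m) :
    (AddMonoid.exponent G).factorization p = m := by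
  have hE := hG.exponent_ne_zero
  obtain ⟨⟨j, hj, rfl⟩, hmax⟩ := hm
  apply le_antisymm
  · by_contra! hlt
    have hpE : p ^ (e j + 1) ∣ AddMonoid.exponent G := (hp.pow_dvd_iff_le_factorization hE).2 hlt
    obtain ⟨b, hb⟩ := dvd_trans (Dvd.intro_left (p ^ e j) rfl : p ∣ p ^ (e j + 1)) hpE
    have hb0 : b ≠ 0 := by rintro rfl; exact hE (by simpa using hb)
    have hdb : AddMonoid.exponent G ∣ b := by
      refine decomp_exponent_dvd hq φ b fun i => ?_
      by_cases hi : q i = p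
      · rw [hi]
        refine dvd_trans (pow_dvd_pow p (hmax ⟨i, hi, rfl⟩)) ?_
        rw [hb, pow_succ, mul_comm] at hpE
        exact Nat.dvd_of_mul_dvd_mul_left hp.pos hpE
      · have h := decomp_dvd_exponent φ i
        rw [hb] at h
        exact (Nat.Coprime.pow_left _ ((Nat.coprime_primes (hq i) hp).2 hi)).dvd_of_dvd_mul_left h
    have := Nat.le_of_dvd (Nat.pos_of_ne_zero hb0) hdb
    rw [hb] at this
    have := hp.two_le
    nlinarith [Nat.pos_of_ne_zero hb0]
  · rw [← hp.pow_dvd_iff_le_factorization hE, ← hj]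
    exact decomp_dvd_exponent φ j

/-- In a bounded direct sum of nontrivial cyclic groups `ℤ / q ^ e` with `q` prime, the primes that
occur are those that divide `exp G`. -/
theorem decomp_mem_primeFactors (hq : ∀ j, (q j).Prime) (he : ∀ j, e j ≠ 0)
    (φ : G ≃+ ⨁ j, ZMod (q j ^ e j)) (hG : AddMonoid.ExponentExists G) (p : ℕ) :
    p ∈ (AddMonoid.exponent G).primeFactors ↔ ∃ j, q j = p := by
  have hE := hG.exponent_ne_zero
  constructor
  · intro h
    have hp := Nat.prime_of_mem_primeFactors h
    obtain ⟨b, hb⟩ := Nat.dvd_of_mem_primeFactors h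
    by_contra! hne
    have hb0 : b ≠ 0 := by rintro rfl; exact hE (by simpa using hb)
    have hdb : AddMonoid.exponent G ∣ b := by
      refine decomp_exponent_dvd hq φ b fun i => ?_
      have h := decomp_dvd_exponent φ i
      rw [hb] at h
      exact (Nat.Coprime.pow_left _
        ((Nat.coprime_primes (hq i) hp).2 (hne i))).dvd_of_dvd_mul_left h
    have := Nat.le_of_dvd (Nat.pos_of_ne_zero hb0) hdb
    rw [hb] at this
    have := hp.two_le
    nlinarith [Nat.pos_of_ne_zero hb0]
  · rintro ⟨j, rfl⟩
    exact Nat.mem_primeFactors.2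
      ⟨hq j, dvd_trans (dvd_pow_self _ (he j)) (decomp_dvd_exponent φ j), hE⟩

/-- The leading Ulm–Kaplansky invariant at `p` is the number of summands `ℤ / p ^ m` with the
largest `m` that occurs, in any decomposition of the bounded group `G` into a direct sum of
nontrivial cyclic groups of prime power order. -/
theorem leadingUlmKaplanskyInvariant_eq {G : Type u} [AddCommGroup G] {J : Type v} {q e : J → ℕ}
    (hq : ∀ j, (q j).Prime) (he : ∀ j, e j ≠ 0) (φ : G ≃+ ⨁ j, ZMod (q j ^ e j))
    (hG : AddMonoid.ExponentExists G) {p m : ℕ} (hp : p.Prime)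
    (hm : IsGreatest {k | ∃ j, q j = p ∧ e j = k} m) :
    Cardinal.lift.{v} (leadingUlmKaplanskyInvariant G p) =
      Cardinal.lift.{u} #{j : J // q j = p ∧ e j = m} := by
  have h1 : m - 1 + 1 = m := by
    obtain ⟨⟨j, -, rfl⟩, -⟩ := hm
    have := he j
    omega
  rw [leadingUlmKaplanskyInvariant, decomp_factorization hq φ hG hp hm,
    ulmKaplanskyInvariant_eq hq φ hp, h1]

end Decomposition

/-! Necessity: let `m = exp G / p`. In a Hausdorff group topology the kernel of multiplication by
`m` is closed. If `mG` is finite, this kernel has finite index and hence contains the von Neumann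
radical, so the cyclic group generated by an `x` with `m • x ≠ 0` is not a radical. Since `mG = (p ^
n G)[p]` with `p ^ (n + 1)` the full power of `p` in `exp G`, finiteness of `mG` means finiteness of
the leading invariant at `p` (`aleph0_le_leadingUlmKaplanskyInvariant_iff`).

Sufficiency: list `H` as `h k`, each element infinitely often, and choose blocks `e k` of `k + 1`
elements independent modulo a growing finite subgroup `F k`. Take a topology in which all `e k i`
and all `h k + ∑ i, e k i` tend to zero. Characters of a bounded group take finitely many values, so
a continuous one is `1` on almost all these elements, hence on almost all `h k`, hence on `H`.
Conversely, the blocks are chosen in the kernels of characters that separate points from `H`, which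
makes those characters continuous.

The topology is Hausdorff because a neighbourhood of zero can be limited to at most `k` terms from
block `k`, too few to cancel the block sum of `k + 1` independent elements
(`sum_blockTerm_eq_zero`). It is complete by a diagonal argument over the compact sets of sums of
boundedly many terms (`completeSpace_of_budgetNhd`). -/

/-! ### Complete group topologies in which a given family tends to zero. -/

section BudgetTopology

open Filter Topology Pointwise

variable {G ι : Type*} [AddCommGroup G]

/-- The sums of multisets of terms of the family `a` that have, for every `n`, at most `f n` terms
of rank at most `n`. -/
def budgetNhd (a : ι → G) (r : ι → ℕ) (f : ℕ → ℕ) : Set G :=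
  {x | ∃ s : Multiset ι, (∀ n, s.countP (r · ≤ n) ≤ f n) ∧ (s.map a).sum = x}

/-- The sums of at most `n` terms of the family `a`. -/
def boundedSums (a : ι → G) (n : ℕ) : Set G :=
  {x | ∃ s : Multiset ι, s.card ≤ n ∧ (s.map a).sum = x}

theorem zero_mem_budgetNhd (a : ι → G) (r : ι → ℕ) (f : ℕ → ℕ) : 0 ∈ budgetNhd a r f :=
  ⟨0, by simp, by simp⟩

theorem budgetNhd_mono (a : ι → G) (r : ι → ℕ) {f g : ℕ → ℕ} (h : ∀ n, f n ≤ g n) :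
    budgetNhd a r f ⊆ budgetNhd a r g := by
  rintro x ⟨s, hs, rfl⟩
  exact ⟨s, fun n => (hs n).trans (h n), rfl⟩

theorem exists_mem_boundedSums_of_mem_budgetNhd (a : ι → G) (r : ι → ℕ) (f : ℕ → ℕ) {x : G}
    (hx : x ∈ budgetNhd a r f) : ∃ n, x ∈ boundedSums a n := by
  obtain ⟨s, -, rfl⟩ := hx
  exact ⟨s.card, s, le_rfl, rfl⟩

theorem boundedSums_add (a : ι → G) {m n : ℕ} {x y : G} (hx : x ∈ boundedSums a m)
    (hy : y ∈ boundedSums a n) : x + y ∈ boundedSums a (m + n) := by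
  obtain ⟨s, hs, rfl⟩ := hx
  obtain ⟨t, ht, rfl⟩ := hy
  exact ⟨s + t, by simpa using add_le_add hs ht, by simp⟩

/-- The filter basis at zero formed by the sets `budgetNhd a r f` with `f` tending to infinity. -/
abbrev budgetBasis (a : ι → G) (r : ι → ℕ) {N : ℕ} (hN : N ≠ 0) (hG : ∀ x : G, N • x = 0) :
    AddGroupFilterBasis G where
  sets := {U | ∃ f : ℕ → ℕ, Tendsto f atTop atTop ∧ budgetNhd a r f = U}
  nonempty := ⟨_, id, tendsto_id, rfl⟩
  inter_sets := by
    rintro _ _ ⟨f, hf, rfl⟩ ⟨g, hg, rfl⟩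
    refine ⟨_, ⟨fun n => min (f n) (g n), ?_, rfl⟩, Set.subset_inter
      (budgetNhd_mono a r fun n => min_le_left _ _) (budgetNhd_mono a r fun n => min_le_right _ _)⟩
    rw [tendsto_atTop] at hf hg ⊢
    intro b
    filter_upwards [hf b, hg b] with n h1 h2 using le_min h1 h2
  zero' := by
    rintro _ ⟨f, -, rfl⟩
    exact zero_mem_budgetNhd a r f
  add' := by
    rintro _ ⟨f, hf, rfl⟩
    refine ⟨_, ⟨fun n => f n / 2, (Nat.tendsto_div_const_atTop two_ne_zero).comp hf, rfl⟩, ?_⟩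
    rintro _ ⟨_, ⟨s, hs, rfl⟩, _, ⟨t, ht, rfl⟩, rfl⟩
    refine ⟨s + t, fun n => ?_, by simp⟩
    rw [Multiset.countP_add]
    have h₁ : s.countP (r · ≤ n) ≤ f n / 2 := hs n
    have h₂ : t.countP (r · ≤ n) ≤ f n / 2 := ht n
    omega
  neg' := by
    rintro _ ⟨f, hf, rfl⟩
    refine ⟨_, ⟨fun n => f n / N, (Nat.tendsto_div_const_atTop hN).comp hf, rfl⟩, ?_⟩
    rintro _ ⟨s, hs, rfl⟩
    -- As `N` kills the group, `-x = (N - 1) • x`, so no negative terms are needed; the budget `f n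
    -- / N` pays for the copies.
    refine ⟨(N - 1) • s, fun n => ?_, ?_⟩
    · rw [Multiset.countP_nsmul]
      calc (N - 1) * s.countP (r · ≤ n) ≤ N * (f n / N) :=
            Nat.mul_le_mul (Nat.sub_le _ _) (hs n)
        _ ≤ f n := Nat.mul_div_le _ _
    · rw [Multiset.map_nsmul, Multiset.sum_nsmul, eq_neg_iff_add_eq_zero, ← succ_nsmul,
        Nat.sub_add_cancel (Nat.one_le_iff_ne_zero.2 hN), hG]
  conj' := by
    rintro x _ ⟨f, hf, rfl⟩
    refine ⟨_, ⟨f, hf, rfl⟩, fun y hy => ?_⟩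
    simpa using hy

theorem budgetBasis_nhds_zero (a : ι → G) (r : ι → ℕ) {N : ℕ} (hN : N ≠ 0)
    (hG : ∀ x : G, N • x = 0) :
    (@nhds G (budgetBasis a r hN hG).topology 0).HasBasis
      (fun f : ℕ → ℕ => Tendsto f atTop atTop) (budgetNhd a r) := by
  refine (budgetBasis a r hN hG).nhds_zero_hasBasis.to_hasBasis ?_ ?_
  · rintro _ ⟨f, hf, rfl⟩
    exact ⟨f, hf, subset_rfl⟩
  · intro f hf
    exact ⟨_, ⟨f, hf, rfl⟩, subset_rfl⟩

/-- Removing `n` terms of smallest rank from a multiset lowers the number of terms of rank at most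
`m` by `n`, as far as possible. -/
theorem exists_add_countP_le (r : ι → ℕ) (n : ℕ) (s : Multiset ι) :
    ∃ t w : Multiset ι, s = t + w ∧ t.card ≤ n ∧
      ∀ m, w.countP (r · ≤ m) ≤ s.countP (r · ≤ m) - n := by
  classical
  induction n with
  | zero => exact ⟨0, s, by simp, by simp, by simp⟩
  | succ n ih =>
    obtain ⟨t, w, hs, ht, hw⟩ := ih
    rcases Multiset.empty_or_exists_mem w with rfl | ⟨i, hi⟩
    · exact ⟨t, 0, hs, by omega, by simp⟩
    obtain ⟨j, hj, hmin⟩ := w.toFinset.exists_min_image r ⟨i, by simpa using hi⟩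
    obtain ⟨w', rfl⟩ := Multiset.exists_cons_of_mem (Multiset.mem_toFinset.1 hj)
    refine ⟨j ::ₘ t, w', by rw [hs]; simp, by simpa using ht, fun m => ?_⟩
    have h := hw m
    by_cases hm : r j ≤ m
    · rw [Multiset.countP_cons_of_pos (p := (r · ≤ m)) _ hm] at h
      omega
    -- The removed `j` has least rank, so if its rank exceeds `m`, nothing of rank at most `m` is
    -- left.
    · have : w'.countP (r · ≤ m) = 0 := by
        rw [Multiset.countP_eq_zero]
        intro k hk
        have := hmin k (by simp [hk])
        omega
      omega

variable [TopologicalSpace G] {a : ι → G} {r : ι → ℕ}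

/-- Once `f ≥ 1` from `n` on, every single term of rank above `n` is within budget, and only
finitely many terms have smaller rank. -/
theorem tendsto_cofinite_of_budgetNhd
    (hb : (𝓝 (0 : G)).HasBasis (fun f : ℕ → ℕ => Tendsto f atTop atTop) (budgetNhd a r))
    (hr : ∀ n, {i | r i ≤ n}.Finite) : Tendsto a cofinite (𝓝 0) := by
  rw [hb.tendsto_right_iff]
  intro f hf
  obtain ⟨n, hn⟩ := eventually_atTop.1 (tendsto_atTop.1 hf 1)
  rw [eventually_cofinite]
  refine (hr n).subset fun i hi => ?_
  by_contra hlt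
  refine hi ⟨{i}, fun m => ?_, by simp⟩
  by_cases him : r i ≤ m
  · calc Multiset.countP (r · ≤ m) {i} ≤ ({i} : Multiset ι).card := Multiset.countP_le_card _ _
      _ = 1 := by simp
      _ ≤ f m := hn m (by simp at hlt; omega)
  · rw [Multiset.countP_eq_zero.2 (by simpa using him)]
    exact Nat.zero_le _

variable [IsTopologicalAddGroup G]

/-- The family together with its limit `0` is compact, and allowing one more term adds this compact
set. -/
theorem isCompact_boundedSums (ha : Tendsto a cofinite (𝓝 0)) (n : ℕ) :
    IsCompact (boundedSums a n) := by
  induction n with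
  | zero =>
    have : boundedSums a 0 = {0} := by
      ext x
      simp [boundedSums, eq_comm]
    rw [this]
    exact isCompact_singleton
  | succ n ih =>
    have : boundedSums a (n + 1) = boundedSums a n + insert 0 (Set.range a) := by
      ext x
      constructor
      · rintro ⟨s, hs, rfl⟩
        induction s using Multiset.induction_on with
        | empty => exact ⟨0, ⟨0, by simp, by simp⟩, 0, by simp, by simp⟩
        | cons i s _ =>
          exact ⟨_, ⟨s, by simpa using hs, rfl⟩, a i, by simp, by simp [add_comm]⟩
      · rintro ⟨_, ⟨s, hs, rfl⟩, _, rfl | ⟨i, rfl⟩, rfl⟩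
        · exact ⟨s, by omega, by simp⟩
        · exact ⟨i ::ₘ s, by simpa using hs, by simp [add_comm]⟩
    rw [this]
    exact ih.add ha.isCompact_insert_range_of_cofinite

/-- A group topology with the neighbourhood basis `budgetNhd a r f` at zero is complete. -/
theorem completeSpace_of_budgetNhd
    (hb : (𝓝 (0 : G)).HasBasis (fun f : ℕ → ℕ => Tendsto f atTop atTop) (budgetNhd a r))
    (hr : ∀ n, {i | r i ≤ n}.Finite) :
    @CompleteSpace G (IsTopologicalAddGroup.rightUniformSpace G) := by
  let := IsTopologicalAddGroup.rightUniformSpace G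
  have ha := tendsto_cofinite_of_budgetNhd hb hr
  refine ⟨fun {l} hl => ?_⟩
  by_contra! hlim
  have hcauchy : ∀ U ∈ 𝓝 (0 : G), ∃ F ∈ l, ∀ x ∈ F, ∀ y ∈ F, y - x ∈ U := by
    intro U hU
    have hU' : {p : G × G | p.2 - p.1 ∈ U} ∈ uniformity G := by
      have : uniformity G = comap (fun p : G × G => p.2 + -p.1) (𝓝 0) := rfl
      rw [this]
      simp only [sub_eq_add_neg]
      exact preimage_mem_comap hU
    obtain ⟨F, hF, hFU⟩ := (cauchy_iff.1 hl).2 _ hU'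
    exact ⟨F, hF, fun x hx y hy => hFU (Set.mk_mem_prod hx hy)⟩
  have : l.NeBot := hl.1
  obtain ⟨F₀, hF₀, hF₀U⟩ := hcauchy _ (hb.mem_of_mem tendsto_id)
  obtain ⟨x₀, hx₀⟩ := nonempty_of_mem hF₀
  -- A Cauchy filter without a limit has no cluster point, so it stays uniformly away from each
  -- compact set.
  have hsep : ∀ n, ∃ f : ℕ → ℕ, Tendsto f atTop atTop ∧
      ((x₀ +ᵥ boundedSums a n) + budgetNhd a r f)ᶜ ∈ l := by
    intro n
    have hK : IsCompact (x₀ +ᵥ boundedSums a n) := (isCompact_boundedSums ha n).vadd x₀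
    have hd : Disjoint (𝓝ˢ (x₀ +ᵥ boundedSums a n)) l := by
      rw [hK.disjoint_nhdsSet_left]
      intro z _
      by_contra hz
      exact hlim z (le_nhds_of_cauchy_adhp hl (neBot_iff.2 (disjoint_iff.not.1 hz)))
    obtain ⟨S, hS, T, hT, hST⟩ := Filter.disjoint_iff.1 hd
    obtain ⟨O, hO, hKO, hOS⟩ := mem_nhdsSet_iff_exists.1 hS
    obtain ⟨V, hV, hKV⟩ := compact_open_separated_add_right hK hO hKO
    obtain ⟨f, hf, hfV⟩ := hb.mem_iff.1 hV
    refine ⟨f, hf, mem_of_superset hT fun y hy hmem => ?_⟩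
    exact Set.disjoint_left.1 hST (hOS (hKV (Set.add_subset_add_left hfV hmem))) hy
  choose f hf hfl using hsep
  -- The summand `n` lets `g` tend to infinity, since only the finitely many `f (2 * n)` with `n <
  -- b` must be large to get `g ≥ b`. Still `g` exceeds `f (2 * n)` by at most `n`, which removing
  -- `n` terms repairs.
  let g : ℕ → ℕ := fun m => ⨅ n, (f (2 * n) m + n)
  have hg : Tendsto g atTop atTop := by
    rw [tendsto_atTop]
    intro b
    have h : ∀ᶠ m in atTop, ∀ n ∈ Finset.range b, b ≤ f (2 * n) m :=
      (Finset.eventually_all _).2 fun n _ => tendsto_atTop.1 (hf (2 * n)) b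
    filter_upwards [h] with m hm
    refine le_ciInf fun n => ?_
    rcases lt_or_ge n b with hn | hn
    · exact (hm n (Finset.mem_range.2 hn)).trans (Nat.le_add_right _ _)
    · omega
  obtain ⟨F, hF, hFU⟩ := hcauchy _ (hb.mem_of_mem hg)
  obtain ⟨x, hxF, hxF₀⟩ := nonempty_of_mem (inter_mem hF hF₀)
  obtain ⟨m, hm⟩ := exists_mem_boundedSums_of_mem_budgetNhd a r _ (hF₀U x₀ hx₀ x hxF₀)
  obtain ⟨y, hyF, hy⟩ := nonempty_of_mem (inter_mem hF (hfl (2 * m)))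
  refine hy ?_
  obtain ⟨s, hs, hsy⟩ := hFU x hxF y hyF
  obtain ⟨t, w, rfl, ht, hw⟩ := exists_add_countP_le r m s
  -- The `m` terms of `x - x₀` and the at most `m` removed terms `t` give the bound `2 * m`; the
  -- rest `w` fits `f (2 * m)`. So `y` lies in the set it was chosen to avoid.
  refine ⟨x₀ + ((x - x₀) + (t.map a).sum), ⟨_, ?_, rfl⟩, (w.map a).sum, ⟨w, fun n => ?_, rfl⟩, ?_⟩
  · rw [two_mul]
    exact boundedSums_add a hm ⟨t, ht, rfl⟩
  · have h1 : g n ≤ f (2 * m) n + m := ciInf_le (OrderBot.bddBelow _) m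
    have h2 := hw n
    have h3 := hs n
    omega
  · rw [Multiset.map_add, Multiset.sum_add, eq_sub_iff_add_eq] at hsy
    simp only
    rw [← hsy]
    abel

end BudgetTopology

/-! ### Circle-valued characters of bounded groups. -/

section Characters

open Filter Topology

/-- The embedding of `ℚ / ℤ` into the circle group. -/
noncomputable def ratCircleHom : AddCircle (1 : ℚ) →+ AddCircle (1 : ℝ) :=
  QuotientAddGroup.map _ (AddSubgroup.zmultiples (1 : ℝ)) (Rat.castHom ℝ).toAddMonoidHom (by
    rw [AddSubgroup.zmultiples_le]
    simp)

theorem ratCircleHom_injective : Function.Injective ratCircleHom := by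
  rw [injective_iff_map_eq_zero]
  intro x
  induction x using QuotientAddGroup.induction_on with
  | H q =>
    intro h
    have h' : (((q : ℝ) : ℝ) : AddCircle (1 : ℝ)) = 0 := h
    rw [AddCircle.coe_eq_zero_iff] at h'
    obtain ⟨n, hn⟩ := h'
    refine (AddCircle.coe_eq_zero_iff (1 : ℚ)).2 ⟨n, ?_⟩
    simp only [zsmul_eq_mul, mul_one] at hn ⊢
    exact_mod_cast hn

variable {G : Type*} [AddCommGroup G]

/-- Characters separate a subgroup from the points outside it. -/
theorem exists_addChar_circle_ne_one {A : AddSubgroup G} {x : G} (hx : x ∉ A) :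
    ∃ χ : AddChar G Circle, (∀ y ∈ A, χ y = 1) ∧ χ x ≠ 1 := by
  have hx' : (x : G ⧸ A) ≠ 0 := by rwa [Ne, QuotientAddGroup.eq_zero_iff]
  obtain ⟨c, hc⟩ := CharacterModule.exists_character_apply_ne_zero_of_ne_zero hx'
  let ψ : G → AddCircle (1 : ℝ) := fun y => ratCircleHom (c (y : G ⧸ A))
  refine ⟨⟨fun y => (ψ y).toCircle, ?_, ?_⟩, ?_, ?_⟩
  · have : ψ 0 = 0 := by
      change ratCircleHom (c ((0 : G) : G ⧸ A)) = 0
      rw [QuotientAddGroup.mk_zero, map_zero, map_zero]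
    rw [this, AddCircle.toCircle_zero]
  · intro y z
    have : ψ (y + z) = ψ y + ψ z := by
      change ratCircleHom (c ((y + z : G) : G ⧸ A)) = _
      rw [QuotientAddGroup.mk_add, map_add, map_add]
    rw [this, AddCircle.toCircle_add]
  · intro y hy
    have : ψ y = 0 := by
      change ratCircleHom (c (y : G ⧸ A)) = 0
      rw [(QuotientAddGroup.eq_zero_iff y).2 hy, map_zero, map_zero]
    change (ψ y).toCircle = 1
    rw [this, AddCircle.toCircle_zero]
  · intro h
    have h' : (ψ x).toCircle = (0 : AddCircle (1 : ℝ)).toCircle := h.trans AddCircle.toCircle_zero.symm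
    have h0 : ψ x = 0 := AddCircle.injective_toCircle one_ne_zero h'
    exact hc ((injective_iff_map_eq_zero _).1 ratCircleHom_injective _ h0)

theorem AddChar.continuous_of_eventually_eq_one [TopologicalSpace G] [IsTopologicalAddGroup G]
    (χ : AddChar G Circle) (h : ∀ᶠ x in 𝓝 (0 : G), χ x = 1) : Continuous χ := by
  rw [continuous_iff_continuousAt]
  intro x
  have ht : Tendsto (fun y => y - x) (𝓝 x) (𝓝 0) := by
    rw [← sub_self x]
    exact tendsto_id.sub_const x
  refine (continuousAt_const (y := χ x)).congr ?_
  filter_upwards [ht.eventually h] with y hy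
  rw [← mul_one (χ x), ← hy, ← AddChar.map_add_eq_mul, add_sub_cancel]

theorem Circle.finite_setOf_pow_eq_one {N : ℕ} (hN : N ≠ 0) : {z : Circle | z ^ N = 1}.Finite := by
  refine ((Polynomial.nthRoots N (1 : ℂ)).toFinset.finite_toSet.preimage
    (Circle.coe_injective.injOn)).subset fun z hz => ?_
  simp only [Set.mem_preimage, Finset.mem_coe, Multiset.mem_toFinset,
    Polynomial.mem_nthRoots (Nat.pos_of_ne_zero hN)]
  exact_mod_cast congrArg (fun w : Circle => (w : ℂ)) hz

theorem AddChar.circle_pow_eq_one {N : ℕ} (hG : ∀ x : G, N • x = 0) (χ : AddChar G Circle) (x : G) :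
    χ x ^ N = 1 := by
  rw [← AddChar.map_nsmul_eq_pow, hG, AddChar.map_zero_eq_one]

/-- If the values of a character of a bounded group tend to `1`, they are eventually `1`. -/
theorem AddChar.eventually_eq_one_of_tendsto {α : Type*} {l : Filter α} {N : ℕ} (hN : N ≠ 0)
    (hG : ∀ x : G, N • x = 0) (χ : AddChar G Circle) {a : α → G}
    (h : Tendsto (fun i => χ (a i)) l (𝓝 1)) : ∀ᶠ i in l, χ (a i) = 1 := by
  have hfin : {z : Circle | z ^ N = 1 ∧ z ≠ 1}.Finite :=
    (Circle.finite_setOf_pow_eq_one hN).subset fun z hz => hz.1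
  -- All values are `N`-th roots of unity, among which `1` is isolated.
  have hV : {z : Circle | z ^ N = 1 ∧ z ≠ 1}ᶜ ∈ 𝓝 (1 : Circle) :=
    hfin.isClosed.isOpen_compl.mem_nhds (by simp)
  filter_upwards [h hV] with i hi
  by_contra hne
  exact hi ⟨χ.circle_pow_eq_one hG _, hne⟩

/-- A closed subgroup of finite index contains the von Neumann radical. -/
theorem vonNeumannRadical_le_of_finiteIndex [TopologicalSpace G] [IsTopologicalAddGroup G]
    (A : AddSubgroup G) [A.FiniteIndex] (hA : IsClosed (A : Set G)) : vonNeumannRadical G ≤ A := by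
  intro x hx
  by_contra hxA
  obtain ⟨χ, hχ, hne⟩ := exists_addChar_circle_ne_one hxA
  refine hne (hx χ (χ.continuous_of_eventually_eq_one ?_))
  filter_upwards [(A.isOpen_of_isClosed_of_finiteIndex hA).mem_nhds A.zero_mem] with y hy
    using hχ y hy

end Characters

/-! ### The leading invariants in terms of `(exp G / p) G`, and necessity. -/

section LeadingInvariant

variable {G : Type*} [AddCommGroup G]

theorem AddMonoid.ExponentExists.exponent_eq_mul (hG : AddMonoid.ExponentExists G) {p : ℕ}
    (hp : p ∈ (AddMonoid.exponent G).primeFactors) :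
    ∃ n b, (AddMonoid.exponent G).factorization p = n + 1 ∧ p.Coprime b ∧
      AddMonoid.exponent G = p ^ (n + 1) * b ∧ AddMonoid.exponent G / p = p ^ n * b := by
  have hpp := Nat.prime_of_mem_primeFactors hp
  have hE := hG.exponent_ne_zero
  have hpos : 0 < (AddMonoid.exponent G).factorization p :=
    hpp.factorization_pos_of_dvd hE (Nat.dvd_of_mem_primeFactors hp)
  obtain ⟨n, hn⟩ := Nat.exists_eq_succ_of_ne_zero hpos.ne'
  have hmul := Nat.ordProj_mul_ordCompl_eq_self (AddMonoid.exponent G) p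
  have hco := Nat.coprime_ordCompl hpp hE
  rw [hn] at hmul hco
  refine ⟨n, _, hn, hco, hmul.symm, ?_⟩
  conv_lhs => rw [← hmul]
  rw [pow_succ, mul_assoc, mul_left_comm, Nat.mul_div_cancel_left _ hpp.pos]

/-- With `exp G / p = p ^ n * b` and `b` prime to `p`, multiplication by `b` is invertible on
elements killed by `p`, so the factor `b` does not shrink the image. -/
theorem range_exponent_div_eq_pSocle (hG : AddMonoid.ExponentExists G) {p : ℕ}
    (hp : p ∈ (AddMonoid.exponent G).primeFactors) :
    (nsmulAddMonoidHom (α := G) (AddMonoid.exponent G / p)).range =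
      pSocle G p ((AddMonoid.exponent G).factorization p - 1) := by
  obtain ⟨n, b, hn, hco, hE, hdiv⟩ := hG.exponent_eq_mul hp
  ext x
  rw [hn, hdiv, Nat.add_sub_cancel, mem_pSocle]
  constructor
  · rintro ⟨y, rfl⟩
    refine ⟨?_, b • y, ?_⟩
    · have := AddMonoid.exponent_nsmul_eq_zero y
      rw [hE] at this
      rw [← this, nsmulAddMonoidHom_apply, smul_smul]
      congr 1
      ring
    · rw [nsmulAddMonoidHom_apply, smul_smul]
  · rintro ⟨hx, y, rfl⟩
    obtain ⟨k, hk⟩ := Nat.exists_mul_mod_eq_one_of_coprime hco.symm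
      (Nat.prime_of_mem_primeFactors hp).one_lt
    refine ⟨k • y, ?_⟩
    rw [nsmulAddMonoidHom_apply, smul_smul]
    calc (p ^ n * b * k) • y = (b * k) • (p ^ n • y) := by rw [smul_smul]; congr 1; ring
      _ = (b * k % p + p * (b * k / p)) • (p ^ n • y) := by rw [Nat.mod_add_div]
      _ = p ^ n • y := by
        rw [add_smul, hk.2, one_smul, mul_comm p, mul_smul, hx, smul_zero, add_zero]

/-- Its elements are killed both by `p` and by the part of `exp G` prime to `p`. Hence the quotient
defining the leading invariant is the socle itself. -/
theorem pSocle_factorization_eq_bot (hG : AddMonoid.ExponentExists G) {p : ℕ}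
    (hp : p ∈ (AddMonoid.exponent G).primeFactors) :
    pSocle G p ((AddMonoid.exponent G).factorization p - 1 + 1) = ⊥ := by
  obtain ⟨n, b, hn, hco, hE, -⟩ := hG.exponent_eq_mul hp
  rw [eq_bot_iff, hn, Nat.add_sub_cancel]
  intro x hx
  obtain ⟨hpx, y, rfl⟩ := mem_pSocle.1 hx
  have hb : b • (p ^ (n + 1) • y) = 0 := by
    rw [smul_smul, mul_comm, ← hE, AddMonoid.exponent_nsmul_eq_zero]
  rw [AddSubgroup.mem_bot, ← AddMonoid.addOrderOf_eq_one_iff]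
  exact Nat.eq_one_of_dvd_coprimes hco (addOrderOf_dvd_of_nsmul_eq_zero hpx)
    (addOrderOf_dvd_of_nsmul_eq_zero hb)

/-- The leading Ulm–Kaplansky invariant at `p` is infinite if and only if `(exp G / p) G` is. -/
theorem aleph0_le_leadingUlmKaplanskyInvariant_iff (hG : AddMonoid.ExponentExists G) {p : ℕ}
    (hp : p ∈ (AddMonoid.exponent G).primeFactors) :
    ℵ₀ ≤ leadingUlmKaplanskyInvariant G p ↔
      Infinite (nsmulAddMonoidHom (α := G) (AddMonoid.exponent G / p)).range := by
  have : Fact p.Prime := ⟨Nat.prime_of_mem_primeFactors hp⟩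
  rw [range_exponent_div_eq_pSocle hG hp, leadingUlmKaplanskyInvariant, ulmKaplanskyInvariant]
  set n := (AddMonoid.exponent G).factorization p - 1 with hn
  have hbij : Function.Bijective (QuotientAddGroup.mk : pSocle G p n → UlmKaplanskyQuotient G p n) := by
    refine ⟨fun x y hxy => ?_, QuotientAddGroup.mk_surjective⟩
    have hbot : pSocle G p (n + 1) = ⊥ := pSocle_factorization_eq_bot hG hp
    rw [QuotientAddGroup.eq, AddSubgroup.mem_addSubgroupOf, hbot, AddSubgroup.mem_bot] at hxy
    exact neg_add_eq_zero.1 (Subtype.ext hxy)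
  rw [(Equiv.ofBijective _ hbij).infinite_iff, ← not_iff_not, not_le, not_infinite_iff_finite,
    Module.rank_lt_aleph0_iff]
  exact ⟨fun _ => Module.finite_of_finite (ZMod p), fun _ => inferInstance⟩

/-- The necessity part of the characterization: already the finite subgroups force the leading
Ulm–Kaplansky invariants to be infinite. -/
theorem aleph0_le_leadingUlmKaplanskyInvariant_of_mem_NR (hG : AddMonoid.ExponentExists G)
    (h : ∀ H : AddSubgroup G, Countable H → H ∈ NR G) {p : ℕ}
    (hp : p ∈ (AddMonoid.exponent G).primeFactors) : ℵ₀ ≤ leadingUlmKaplanskyInvariant G p := by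
  rw [aleph0_le_leadingUlmKaplanskyInvariant_iff hG hp]
  by_contra hfin
  rw [not_infinite_iff_finite] at hfin
  set m := AddMonoid.exponent G / p with hm
  have hE := hG.exponent_ne_zero
  have hpp := Nat.prime_of_mem_primeFactors hp
  have hmE : m < AddMonoid.exponent G := Nat.div_lt_self (Nat.pos_of_ne_zero hE) hpp.one_lt
  have hm0 : 0 < m := Nat.div_pos (Nat.le_of_dvd (Nat.pos_of_ne_zero hE)
    (Nat.dvd_of_mem_primeFactors hp)) hpp.pos
  obtain ⟨x, hx⟩ : ∃ x : G, m • x ≠ 0 := by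
    by_contra! hall
    exact hmE.not_ge (Nat.le_of_dvd hm0 (AddMonoid.exponent_dvd_of_forall_nsmul_eq_zero hall))
  obtain ⟨τ, hτ, hT2, -, hrad⟩ := h (AddSubgroup.zmultiples x) inferInstance
  have hker : IsClosed ((nsmulAddMonoidHom (α := G) m).ker : Set G) :=
    isClosed_singleton.preimage (continuous_nsmul m)
  have := AddSubgroup.finiteIndex_ker (nsmulAddMonoidHom (α := G) m)
  exact hx (vonNeumannRadical_le_of_finiteIndex _ hker
    (hrad ▸ AddSubgroup.mem_zmultiples x))

end LeadingInvariant

/-! ### Independent elements of maximal order in subgroups of finite index. -/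

section IndependentElements

open Pointwise

variable {G : Type*} [AddCommGroup G]

/-- The image is covered by finitely many translates of `F`, one for each coset of `A`. -/
theorem finite_range_of_finiteIndex {G' : Type*} [AddCommGroup G'] (ψ : G →+ G')
    (A : AddSubgroup G) [A.FiniteIndex] (F : AddSubgroup G') [Finite F] (h : ∀ x ∈ A, ψ x ∈ F) :
    Finite ψ.range := by
  refine ((Set.finite_range fun z : (G ⧸ A) × F => ψ z.1.out + z.2).subset ?_).to_subtype
  rintro _ ⟨x, rfl⟩
  have hx : -(x : G ⧸ A).out + x ∈ A := by
    rw [← QuotientAddGroup.eq, QuotientAddGroup.out_eq']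
  exact ⟨((x : G ⧸ A), ⟨_, h _ hx⟩), by simp⟩

theorem AddSubgroup.finite_closure_of_nsmul_eq_zero {N : ℕ} (hN : N ≠ 0) (hG : ∀ x : G, N • x = 0)
    {S : Set G} (hS : S.Finite) : Finite (AddSubgroup.closure S) := by
  have : Finite S := hS
  refine AddCommGroup.finite_of_fg_isAddTorsion _ fun x => ?_
  exact isOfFinAddOrder_iff_nsmul_eq_zero.2 ⟨N, Nat.pos_of_ne_zero hN, Subtype.ext (hG x)⟩

/-- Finitely many characters of a bounded group are trivial on a subgroup of finite index. -/
theorem exists_finiteIndex_addChar_eq_one {N : ℕ} (hN : N ≠ 0) (hG : ∀ x : G, N • x = 0)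
    {α : Type*} [Finite α] (χ : α → AddChar G Circle) :
    ∃ D : AddSubgroup G, D.FiniteIndex ∧ ∀ x ∈ D, ∀ i, χ i x = 1 := by
  refine ⟨⨅ i, (χ i).toAddMonoidHom.ker, ?_, fun x hx i => ?_⟩
  · refine AddSubgroup.finiteIndex_iInf fun i => ?_
    have : Finite (χ i).toAddMonoidHom.range := by
      refine (((Circle.finite_setOf_pow_eq_one hN).preimage
        (Additive.toMul.injective.injOn)).subset ?_).to_subtype
      rintro _ ⟨x, rfl⟩
      exact (χ i).circle_pow_eq_one hG x
    exact AddSubgroup.finiteIndex_ker _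
  · exact (AddSubgroup.mem_iInf.1 hx i)

variable {N : ℕ}

/-- By Bézout `c` may be replaced by `gcd c N`, a proper divisor of `N`, which therefore divides
some `N / p`. Failure of independence is thus tested by finitely many multipliers. -/
theorem exists_prime_div_nsmul_mem (hN : N ≠ 0) (hG : ∀ x : G, N • x = 0) {F : AddSubgroup G}
    {x : G} {c : ℕ} (hc : c • x ∈ F) (hNc : ¬ N ∣ c) : ∃ p ∈ N.primeFactors, (N / p) • x ∈ F := by
  have hg : c.gcd N • x ∈ F := by
    rw [← natCast_zsmul, Nat.gcd_eq_gcd_ab, add_smul, mul_comm, mul_smul, mul_comm (N : ℤ),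
      mul_smul, natCast_zsmul, natCast_zsmul, hG, smul_zero, add_zero]
    exact F.zsmul_mem hc _
  obtain ⟨t, ht⟩ := Nat.gcd_dvd_right c N
  have ht1 : t ≠ 1 := by
    rintro rfl
    rw [mul_one] at ht
    exact hNc (ht ▸ Nat.gcd_dvd_left c N)
  obtain ⟨p, hp, w, rfl⟩ := Nat.exists_prime_and_dvd ht1
  refine ⟨p, Nat.mem_primeFactors.2 ⟨hp, ⟨c.gcd N * w, by rw [mul_left_comm, ← ht]⟩, hN⟩, ?_⟩
  have : N / p = w * c.gcd N := by
    refine Nat.div_eq_of_eq_mul_right hp.pos ?_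
    conv_lhs => rw [ht]
    ring
  rw [this, mul_smul]
  exact F.nsmul_mem hg _

/-- If all the groups `(N / p) G` are infinite, every subgroup of finite index contains an element
of order `N` that is independent of a given finite subgroup. -/
theorem exists_mem_forall_nsmul_mem_dvd (hN : N ≠ 0) (hG : ∀ x : G, N • x = 0)
    (hinf : ∀ p ∈ N.primeFactors, Infinite (nsmulAddMonoidHom (α := G) (N / p)).range)
    (D F : AddSubgroup G) [D.FiniteIndex] [Finite F] :
    ∃ x ∈ D, ∀ c : ℕ, c • x ∈ F → N ∣ c := by
  by_contra! hcon
  let ψ : ℕ → D →+ G := fun p => (nsmulAddMonoidHom (α := G) (N / p)).comp D.subtype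
  have hcov : ⋃ p ∈ N.primeFactors, (0 : D) +ᵥ ((F.comap (ψ p) : AddSubgroup D) : Set D) =
      Set.univ := by
    refine Set.eq_univ_of_forall fun x => ?_
    obtain ⟨c, hc, hNc⟩ := hcon x x.2
    obtain ⟨p, hp, hpx⟩ := exists_prime_div_nsmul_mem hN hG hc hNc
    simp only [Set.mem_iUnion, zero_vadd]
    exact ⟨p, hp, hpx⟩
  -- B. H. Neumann's lemma: one of finitely many subgroups covering `D` has finite index. Then `(N /
  -- p) D`, and so `(N / p) G`, is finite.
  obtain ⟨p, hp, _⟩ := AddSubgroup.exists_finiteIndex_of_leftCoset_cover hcov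
  have : Finite (ψ p).range := finite_range_of_finiteIndex (ψ p) (F.comap (ψ p)) F fun x hx => hx
  have := hinf p hp
  exact not_finite_iff_infinite.2 this (finite_range_of_finiteIndex _ D (ψ p).range
    fun x hx => ⟨⟨x, hx⟩, rfl⟩)

theorem exists_family_forall_sum_nsmul_mem_dvd (hN : N ≠ 0) (hG : ∀ x : G, N • x = 0)
    (hinf : ∀ p ∈ N.primeFactors, Infinite (nsmulAddMonoidHom (α := G) (N / p)).range)
    (D F : AddSubgroup G) [D.FiniteIndex] [Finite F] (L : ℕ) :
    ∃ e : Fin L → G, (∀ i, e i ∈ D) ∧ ∀ c : Fin L → ℕ, ∑ i, c i • e i ∈ F → ∀ i, N ∣ c i := by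
  induction L with
  | zero => exact ⟨Fin.elim0, fun i => i.elim0, fun _ _ i => i.elim0⟩
  | succ L ih =>
    obtain ⟨e, heD, he⟩ := ih
    have hS : ((F : Set G) ∪ Set.range e).Finite := (Set.toFinite _).union (Set.finite_range e)
    have := AddSubgroup.finite_closure_of_nsmul_eq_zero hN hG hS
    set F' := AddSubgroup.closure ((F : Set G) ∪ Set.range e)
    obtain ⟨x, hxD, hx⟩ := exists_mem_forall_nsmul_mem_dvd hN hG hinf D F'
    refine ⟨Fin.snoc (α := fun _ => G) e x, fun i => ?_, fun c hc => ?_⟩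
    · refine Fin.lastCases ?_ (fun i => ?_) i
      · simpa using hxD
      · simpa using heD i
    · simp only [Fin.sum_univ_castSucc, Fin.snoc_castSucc, Fin.snoc_last] at hc
      have hsum : ∑ i : Fin L, c i.castSucc • e i ∈ F' :=
        sum_mem fun i _ => F'.nsmul_mem (AddSubgroup.subset_closure (Or.inr ⟨i, rfl⟩)) _
      -- The new element is independent of `F'`, which contains `F` and the earlier elements; so its
      -- term vanishes and the induction hypothesis applies to the others.
      have hlast : N ∣ c (Fin.last L) :=
        hx _ ((F'.add_mem_cancel_left hsum).1 (AddSubgroup.subset_closure (Or.inl hc)))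
      obtain ⟨t, ht⟩ := hlast
      rw [ht, mul_comm, mul_smul, hG, smul_zero, add_zero] at hc
      exact Fin.lastCases ⟨t, ht⟩ (he _ hc)

/-- An increasing sequence of finite subgroups `F k` of a bounded group and blocks `e k` of `k + 1`
elements of order `N` of `F (k + 1)` that are independent modulo `F k`, where `F k` contains a
prescribed element `h k` and `e k` is killed by prescribed characters indexed by `F k`. -/
theorem exists_independent_blocks (hN : N ≠ 0) (hG : ∀ x : G, N • x = 0)
    (hinf : ∀ p ∈ N.primeFactors, Infinite (nsmulAddMonoidHom (α := G) (N / p)).range)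
    (h : ℕ → G) (χ : G → AddChar G Circle) :
    ∃ (F : ℕ → AddSubgroup G) (e : ∀ k, Fin (k + 1) → G), Monotone F ∧ (∀ k, h k ∈ F k) ∧
      (∀ k i, e k i ∈ F (k + 1)) ∧ (∀ k, ∀ x ∈ F k, ∀ i, χ x (e k i) = 1) ∧
      ∀ k, ∀ c : Fin (k + 1) → ℕ, ∑ i, c i • e k i ∈ F k → ∀ i, N ∣ c i := by
  have hstep : ∀ (k : ℕ) (F : {F : AddSubgroup G // Finite F}), ∃ e : Fin (k + 1) → G,
      (∀ x ∈ F.1, ∀ i, χ x (e i) = 1) ∧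
        ∀ c : Fin (k + 1) → ℕ, ∑ i, c i • e i ∈ F.1 → ∀ i, N ∣ c i := by
    rintro k ⟨F, hF⟩
    -- Finiteness of `F` leaves only finitely many characters to kill.
    obtain ⟨D, hD, hDχ⟩ := exists_finiteIndex_addChar_eq_one hN hG fun x : F => χ x
    obtain ⟨e, heD, he⟩ := exists_family_forall_sum_nsmul_mem_dvd hN hG hinf D F (k + 1)
    exact ⟨e, fun x hx i => hDχ _ (heD i) ⟨x, hx⟩, he⟩
  choose E hE₁ hE₂ using hstep
  let next : ∀ k, {F : AddSubgroup G // Finite F} → {F : AddSubgroup G // Finite F} := fun k F =>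
    ⟨AddSubgroup.closure (F.1 ∪ Set.range (E k F) ∪ {h (k + 1)}),
      have := F.2
      AddSubgroup.finite_closure_of_nsmul_eq_zero hN hG
        (((Set.toFinite _).union (Set.finite_range _)).union (Set.finite_singleton _))⟩
  let F : ℕ → {F : AddSubgroup G // Finite F} := Nat.rec
    ⟨AddSubgroup.closure {h 0},
      AddSubgroup.finite_closure_of_nsmul_eq_zero hN hG (Set.finite_singleton _)⟩ next
  refine ⟨fun k => (F k).1, fun k => E k (F k), monotone_nat_of_le_succ fun k x hx => ?_, fun k => ?_,
    fun k i => ?_, fun k => hE₁ k (F k), fun k => hE₂ k (F k)⟩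
  · exact AddSubgroup.subset_closure (Or.inl (Or.inl hx))
  · cases k with
    | zero => exact AddSubgroup.subset_closure rfl
    | succ k => exact AddSubgroup.subset_closure (Or.inr rfl)
  · exact AddSubgroup.subset_closure (Or.inl (Or.inr ⟨i, rfl⟩))

end IndependentElements

/-! ### The topology with a prescribed countable radical. -/

section BlockTopology

open Filter Topology

variable {G : Type*} [AddCommGroup G]

/-- The family formed by the elements `e k i` and the elements `h k + ∑ i, e k i`. -/
def blockTerm (h : ℕ → G) (e : ∀ k, Fin (k + 1) → G) : (Σ k, Option (Fin (k + 1))) → G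
  | ⟨k, none⟩ => h k + ∑ i, e k i
  | ⟨k, some i⟩ => e k i

theorem finite_setOf_block_le (n : ℕ) : {j : Σ k, Option (Fin (k + 1)) | j.1 ≤ n}.Finite := by
  have : {j : Σ k, Option (Fin (k + 1)) | j.1 ≤ n} = ⋃ k ∈ Set.Iic n, Set.range (Sigma.mk k) := by
    ext ⟨k, o⟩
    simp
  rw [this]
  exact (Set.finite_Iic n).biUnion fun k _ => Set.finite_range _

variable {h : ℕ → G} {e : ∀ k, Fin (k + 1) → G} {F : ℕ → AddSubgroup G}

theorem blockTerm_mem (hF : Monotone F) (hh : ∀ k, h k ∈ F k) (he : ∀ k i, e k i ∈ F (k + 1))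
    (j : Σ k, Option (Fin (k + 1))) : blockTerm h e j ∈ F (j.1 + 1) := by
  obtain ⟨k, _ | i⟩ := j
  · exact add_mem (hF (Nat.le_succ k) (hh k)) (sum_mem fun i _ => he k i)
  · exact he k i

theorem sum_blockTerm_mem (hF : Monotone F) (hh : ∀ k, h k ∈ F k) (he : ∀ k i, e k i ∈ F (k + 1))
    {m : ℕ} {s : Multiset (Σ k, Option (Fin (k + 1)))} (hs : ∀ j ∈ s, j.1 < m) :
    (s.map (blockTerm h e)).sum ∈ F m := by
  refine multiset_sum_mem _ fun x hx => ?_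
  obtain ⟨j, hj, rfl⟩ := Multiset.mem_map.1 hx
  exact hF (hs j hj) (blockTerm_mem hF hh he j)

/-- Here `b` counts the occurrences of the element `h m + ∑ i, e m i` and `c i` those of `e m i`. -/
theorem sum_blockTerm_of_fst_eq (h : ℕ → G) (e : ∀ k, Fin (k + 1) → G) {m : ℕ}
    {s : Multiset (Σ k, Option (Fin (k + 1)))} (hs : ∀ j ∈ s, j.1 = m) :
    ∃ (b : ℕ) (c : Fin (m + 1) → ℕ), b + ∑ i, c i = s.card ∧
      (s.map (blockTerm h e)).sum = b • (h m + ∑ i, e m i) + ∑ i, c i • e m i := by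
  induction s using Multiset.induction_on with
  | empty => exact ⟨0, 0, by simp, by simp⟩
  | cons j s ih =>
    obtain ⟨b, c, hbc, hsum⟩ := ih fun i hi => hs i (Multiset.mem_cons_of_mem hi)
    have hj := hs j (Multiset.mem_cons_self j s)
    obtain ⟨k, o⟩ := j
    obtain rfl : k = m := hj
    rcases o with _ | i
    · refine ⟨b + 1, c, by rw [Multiset.card_cons, ← hbc]; ring, ?_⟩
      rw [Multiset.map_cons, Multiset.sum_cons, hsum, blockTerm, succ_nsmul]
      abel
    · refine ⟨b, c + Pi.single i 1, ?_, ?_⟩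
      · simp only [Multiset.card_cons, ← hbc, Pi.add_apply, Finset.sum_add_distrib,
          Finset.sum_pi_single', Finset.mem_univ, if_true]
        ring
      · have : ∑ l, (Pi.single i 1 : Fin (k + 1) → ℕ) l • e k l = e k i := by
          rw [Finset.sum_eq_single i] <;> simp +contextual
        simp only [Multiset.map_cons, Multiset.sum_cons, hsum, blockTerm, Pi.add_apply, add_smul,
          Finset.sum_add_distrib, this]
        abel

/-- A sum of terms from the blocks between `k₀` and `m` with few terms from each block that lies in
`F k₀` vanishes. -/
theorem sum_blockTerm_eq_zero {N : ℕ} (hG : ∀ x : G, N • x = 0) (hF : Monotone F)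
    (hh : ∀ k, h k ∈ F k) (he : ∀ k i, e k i ∈ F (k + 1))
    (hind : ∀ k, ∀ c : Fin (k + 1) → ℕ, ∑ i, c i • e k i ∈ F k → ∀ i, N ∣ c i) {k₀ : ℕ} (m : ℕ)
    {s : Multiset (Σ k, Option (Fin (k + 1)))} (hs : ∀ j ∈ s, j.1 < m)
    (hcount : ∀ n, s.countP (·.1 ≤ n) ≤ if n < k₀ then 0 else n)
    (hmem : (s.map (blockTerm h e)).sum ∈ F k₀) : (s.map (blockTerm h e)).sum = 0 := by
  induction m generalizing s with
  | zero => simp [Multiset.eq_zero_of_forall_notMem fun j hj => Nat.not_lt_zero _ (hs j hj)]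
  | succ m ih =>
    have hcard : (s.filter (·.1 = m)).card ≤ if m < k₀ then 0 else m := by
      rw [← Multiset.countP_eq_card_filter]
      refine le_trans ?_ (hcount m)
      rw [Multiset.countP_eq_card_filter, Multiset.countP_eq_card_filter]
      exact Multiset.card_le_card (Multiset.monotone_filter_right s fun j hj => hj.le)
    have hsplit := Multiset.filter_add_not (·.1 = m) s
    have hsum : (s.map (blockTerm h e)).sum = ((s.filter (·.1 = m)).map (blockTerm h e)).sum +
        ((s.filter (¬ ·.1 = m)).map (blockTerm h e)).sum := by
      conv_lhs => rw [← hsplit, Multiset.map_add, Multiset.sum_add]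
    have hlt : ∀ j ∈ s.filter (¬ ·.1 = m), j.1 < m := by
      intro j hj
      rw [Multiset.mem_filter] at hj
      have := hs j hj.1
      omega
    have htop : ((s.filter (·.1 = m)).map (blockTerm h e)).sum = 0 := by
      by_cases hm : m < k₀
      · rw [if_pos hm, Nat.le_zero, Multiset.card_eq_zero] at hcard
        rw [hcard, Multiset.map_zero, Multiset.sum_zero]
      · rw [if_neg hm] at hcard
        obtain ⟨b, c, hbc, hbcs⟩ := sum_blockTerm_of_fst_eq h e (m := m)
          (s := s.filter (·.1 = m)) fun j hj => (Multiset.mem_filter.1 hj).2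
        have hmem' : b • (h m + ∑ i, e m i) + ∑ i, c i • e m i ∈ F m := by
          rw [← hbcs]
          refine ((F m).add_mem_cancel_right (sum_blockTerm_mem hF hh he hlt)).1 ?_
          rw [← hsum]
          exact hF (not_lt.1 hm) hmem
        -- Modulo `F m` the top block is `∑ i, (b + c i) • e m i`, and it lies in `F m` because the
        -- lower blocks and the whole sum do.
        have hdvd : ∀ i, N ∣ b + c i := by
          refine hind m _ ?_
          rw [smul_add, add_assoc,
            (F m).add_mem_cancel_left ((F m).nsmul_mem (hh m) b)] at hmem'
          simpa only [add_smul, Finset.sum_add_distrib, Finset.smul_sum] using hmem'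
        -- At most `m` terms cannot involve all `m + 1` elements of the block; a missing index
        -- yields `N ∣ b`, and then `N ∣ c i` for every `i`.
        obtain ⟨i₀, hi₀⟩ : ∃ i, c i = 0 := by
          by_contra! hne
          have : ∑ _i : Fin (m + 1), 1 ≤ ∑ i, c i :=
            Finset.sum_le_sum fun i _ => Nat.one_le_iff_ne_zero.2 (hne i)
          simp only [Finset.sum_const, Finset.card_univ, Fintype.card_fin, smul_eq_mul,
            mul_one] at this
          omega
        have hb : N ∣ b := by simpa [hi₀] using hdvd i₀
        have hzero : ∀ (n : ℕ) (x : G), N ∣ n → n • x = 0 := by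
          rintro _ x ⟨t, rfl⟩
          rw [mul_comm, mul_smul, hG, smul_zero]
        rw [hbcs, hzero b _ hb, zero_add]
        exact Finset.sum_eq_zero fun i _ => hzero _ _ ((Nat.dvd_add_right hb).1 (hdvd i))
    rw [htop, zero_add] at hsum
    rw [hsum] at hmem ⊢
    refine ih hlt (fun n => le_trans ?_ (hcount n)) hmem
    exact Multiset.countP_le_of_le _ (Multiset.filter_le _ _)

theorem tendsto_ite_lt_atTop (k₀ : ℕ) :
    Tendsto (fun n : ℕ => if n < k₀ then 0 else n) atTop atTop := by
  refine tendsto_id.congr' ?_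
  filter_upwards [eventually_ge_atTop k₀] with n hn
  simp [not_lt.2 hn]

/-- In a bounded group `G` of exponent dividing `N` such that all groups `(N / p) G` are infinite,
every countable subgroup is the von Neumann radical of a complete non-discrete Hausdorff group
topology. -/
theorem mem_NRC_of_infinite_range {N : ℕ} (hN : N ≠ 0) (hN1 : N ≠ 1) (hG : ∀ x : G, N • x = 0)
    (hinf : ∀ p ∈ N.primeFactors, Infinite (nsmulAddMonoidHom (α := G) (N / p)).range)
    (H : AddSubgroup G) [Countable H] : H ∈ NRC G := by
  classical
  obtain ⟨η, hη⟩ := exists_surjective_nat H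
  -- Unpairing repeats each element of `H` infinitely often.
  let h : ℕ → G := fun k => η k.unpair.1
  have hhH : ∀ k, h k ∈ H := fun k => (η _).2
  have hsep : ∀ x : G, ∃ χ : AddChar G Circle, (∀ y ∈ H, χ y = 1) ∧ (x ∉ H → χ x ≠ 1) := by
    intro x
    by_cases hx : x ∈ H
    · exact ⟨1, by simp, fun h => absurd hx h⟩
    · obtain ⟨χ, h1, h2⟩ := exists_addChar_circle_ne_one hx
      exact ⟨χ, h1, fun _ => h2⟩
  choose χ hχH hχ using hsep
  obtain ⟨F, e, hF, hh, he, heχ, hind⟩ := exists_independent_blocks hN hG hinf h χ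
  set a := blockTerm h e
  let r : (Σ k, Option (Fin (k + 1))) → ℕ := Sigma.fst
  let B := budgetBasis a r hN hG
  let τ : TopologicalSpace G := B.topology
  have hτ : IsTopologicalAddGroup G := B.isTopologicalAddGroup
  have hb : (𝓝 (0 : G)).HasBasis (fun f : ℕ → ℕ => Tendsto f atTop atTop) (budgetNhd a r) :=
    budgetBasis_nhds_zero a r hN hG
  have hlim : Tendsto a cofinite (𝓝 0) := tendsto_cofinite_of_budgetNhd hb finite_setOf_block_le
  have hrank : ∀ s : Multiset (Σ k, Option (Fin (k + 1))), ∀ j ∈ s, j.1 < (s.map Sigma.fst).sum + 1 :=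
    fun s j hj => Nat.lt_succ_of_le
      (Multiset.single_le_sum (fun _ _ => Nat.zero_le _) _ (Multiset.mem_map_of_mem _ hj))
  have hmemF : ∀ f, ∀ x ∈ budgetNhd a r f, ∃ m, x ∈ F m := by
    rintro f _ ⟨s, -, rfl⟩
    exact ⟨_, sum_blockTerm_mem hF hh he (hrank s)⟩
  refine ⟨τ, hτ, completeSpace_of_budgetNhd hb finite_setOf_block_le, ?_, fun hd => ?_, ?_⟩
  · refine IsTopologicalAddGroup.t2Space_of_zero_sep fun x hx => ?_
    by_cases hxF : ∃ k₀, x ∈ F k₀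
    · obtain ⟨k₀, hk₀⟩ := hxF
      refine ⟨_, hb.mem_of_mem (tendsto_ite_lt_atTop k₀), ?_⟩
      rintro ⟨s, hs, rfl⟩
      exact hx (sum_blockTerm_eq_zero hG hF hh he hind _ (hrank s) hs hk₀)
    · exact ⟨_, hb.mem_of_mem tendsto_id, fun hmem => hxF (hmemF _ _ hmem)⟩
  · have hfin : {j | ¬ a j = 0}.Finite := by
      have := hlim.eventually (mem_nhds_discrete.2 (Set.mem_singleton (0 : G)))
      exact eventually_cofinite.1 this
    refine Set.infinite_range_of_injective (f := fun k : ℕ =>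
      (⟨k, some 0⟩ : Σ k, Option (Fin (k + 1)))) (fun k l hkl => congrArg Sigma.fst hkl)
      (hfin.subset ?_)
    rintro _ ⟨k, rfl⟩ h0
    have h0' : e k 0 = 0 := h0
    have := hind k (Pi.single 0 1) (by
      rw [Finset.sum_eq_single 0] <;> simp +contextual [h0']) 0
    exact hN1 (by simpa using this)
  · refine le_antisymm (fun x hx => ?_) fun x hx ξ hξ => ?_
    · by_contra hxH
      by_cases hxF : ∃ k₀, x ∈ F k₀
      · obtain ⟨k₀, hk₀⟩ := hxF
        refine hχ x hxH (hx (χ x) ((χ x).continuous_of_eventually_eq_one ?_))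
        -- This neighbourhood uses only blocks from `k₀` on, and these were chosen in the kernel of
        -- `χ x` since `x ∈ F k₀`.
        filter_upwards [hb.mem_of_mem (tendsto_ite_lt_atTop k₀)]
        rintro _ ⟨s, hs, rfl⟩
        have hker : (s.map a).sum ∈ (χ x).toAddMonoidHom.ker := by
          refine multiset_sum_mem _ fun y hy => ?_
          obtain ⟨⟨k, o⟩, hj, rfl⟩ := Multiset.mem_map.1 hy
          have hk : k₀ ≤ k := by
            by_contra! hlt
            have h0 : s.countP (r · ≤ k) ≤ if k < k₀ then 0 else k := hs k
            rw [if_pos hlt, Nat.le_zero, Multiset.countP_eq_zero] at h0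
            exact h0 _ hj le_rfl
          have hek : ∀ i, e k i ∈ (χ x).toAddMonoidHom.ker := heχ k x (hF hk hk₀)
          rcases o with _ | i
          · exact add_mem (hχH x _ (hhH k)) (sum_mem fun i _ => hek i)
          · exact hek i
        exact hker
      -- The union of the `F k` contains a neighbourhood of zero, so any character trivial on it is
      -- continuous.
      · have hxF' : x ∉ ⨆ k, F k := by
          rwa [AddSubgroup.mem_iSup_of_directed hF.directed_le]
        obtain ⟨ξ, hξ, hne⟩ := exists_addChar_circle_ne_one hxF'
        refine hne (hx ξ (ξ.continuous_of_eventually_eq_one ?_))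
        filter_upwards [hb.mem_of_mem tendsto_id] with y hy
        obtain ⟨m, hm⟩ := hmemF _ y hy
        exact hξ y (AddSubgroup.mem_iSup_of_mem m hm)
    · have hev : ∀ᶠ j in cofinite, ξ (a j) = 1 := by
        refine ξ.eventually_eq_one_of_tendsto hN hG ?_
        rw [← ξ.map_zero_eq_one]
        exact (hξ.tendsto 0).comp hlim
      have hbad := (eventually_cofinite.1 hev).image Sigma.fst
      obtain ⟨n, hn⟩ := hη ⟨x, hx⟩
      have hinj : Function.Injective fun l : ℕ => Nat.pair n l :=
        fun l l' hll => (Nat.pair_eq_pair.1 hll).2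
      -- Among the infinitely many blocks with `h k = x`, one has all its terms in the kernel of
      -- `ξ`; subtracting the `e k i` leaves `x` there.
      obtain ⟨_, ⟨l, rfl⟩, hk⟩ := ((Set.infinite_range_of_injective hinj).sdiff hbad).nonempty
      have hker : ∀ o, a ⟨Nat.pair n l, o⟩ ∈ ξ.toAddMonoidHom.ker := by
        intro o
        by_contra ho
        exact hk ⟨_, ho, rfl⟩
      have hx' : h (Nat.pair n l) = x := by
        simp only [h, Nat.unpair_pair, hn]
      have hmem : h (Nat.pair n l) ∈ ξ.toAddMonoidHom.ker :=
        (AddSubgroup.add_mem_cancel_right _ (sum_mem fun i _ => hker (some i))).1 (hker none)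
      rw [hx'] at hmem
      exact hmem

end BlockTopology

theorem corollary3 {G : Type*} [AddCommGroup G] [Infinite G] (hG : AddMonoid.ExponentExists G) :
    ((∀ H : AddSubgroup G, Countable H → H ∈ NR G) ↔
      ∀ p ∈ (AddMonoid.exponent G).primeFactors, ℵ₀ ≤ leadingUlmKaplanskyInvariant G p) ∧
    ((∀ p ∈ (AddMonoid.exponent G).primeFactors, ℵ₀ ≤ leadingUlmKaplanskyInvariant G p) →
      ∀ H : AddSubgroup G, Countable H → H ∈ NRC G) := by
  have hNRC : (∀ p ∈ (AddMonoid.exponent G).primeFactors,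
      ℵ₀ ≤ leadingUlmKaplanskyInvariant G p) → ∀ H : AddSubgroup G, Countable H → H ∈ NRC G := by
    intro hinv H _
    refine mem_NRC_of_infinite_range hG.exponent_ne_zero (fun h1 => ?_)
      AddMonoid.exponent_nsmul_eq_zero
      (fun p hp => (aleph0_le_leadingUlmKaplanskyInvariant_iff hG hp).1 (hinv p hp)) H
    have := AddMonoid.exp_eq_one_iff.1 h1
    exact not_finite G
  refine ⟨⟨fun h p hp => aleph0_le_leadingUlmKaplanskyInvariant_of_mem_NR hG h hp,
    fun hinv H hH => ?_⟩, hNRC⟩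
  obtain ⟨τ, hτ, -, hT2, hd, hrad⟩ := hNRC hinv H hH
  exact ⟨τ, hτ, hT2, hd, hrad⟩
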